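/- Let $1\le m\le n$, let $\mathbb{R}^{m\times n}$ carry the trace inner product $\langle X,Y\rangle=\mathrm{tr}(X^{\mathsf T}Y)$, let $\sigma(X)\in\mathbb{R}^m$ be the vector of singular values of $X$ in nonincreasing order, and let $\|X\|_*=\sum_i\sigma_i(X)$ and $\|X\|=\sigma_1(X)$ be the nuclear and the spectral norm. Let $\nu>0$, let $\Omega\subseteq\mathbb{R}^{m\times n}$ be closed and convex, and let $f:\mathbb{R}^{m\times n}\to\mathbb{R}$ be locally Lipschitz with $\widehat\partial f(X)=\partial f(X)$ for all $X\in\Omega$. Here, for an extended real-valued $g$ finite at $z$, $\widehat\partial g(z)$ is the regular subdifferential, consisting of all $v$ with $\liminf_{z'\to z,\,z'\ne z}\frac{g(z')-g(z)-\langle v,z'-z\rangle}{\|z'-z\|}\ge 0$ (norm induced by the inner product), and $\partial g(z)$ is the limiting subdifferential, consisting of all limits of sequences $v^k\in\widehat\partial g(z^k)$ with $z^k\to z$ and $g(z^k)\to g(z)$; $\mathcal{N}_\Omega$ is the (limiting) normal cone, empty outside $\Omega$; and $g^*(s)=\sup_x\{\langle s,x\rangle-g(x)\}$ is the conjugate.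 Let $\mathscr{L}$ be the family of proper lower semicontinuous convex $\phi:\mathbb{R}\to(-\infty,+\infty]$ such that $[0,1]\subseteq\mathrm{int}(\mathrm{dom}\,\phi)$, $\phi(1)=1$, and the minimum of $\phi$ over $[0,1]$ equals $0$ and is attained at some $t^*<1$. For $\phi\in\mathscr{L}$ let $\psi=\phi$ on $[0,1]$ and $\psi=+\infty$ elsewhere, $\widehat\psi(t)=\psi(|t|)$ for $t\in\mathbb{R}$, and $\widehat\Psi(x)=\sum_{i=1}^m\widehat\psi(x_i)$ for $x\in\mathbb{R}^m$. A matrix $\overline X$ is called an EP-stationary point (of $\min_X\{\nu f(X)+\mathrm{rank}(X)+\delta_\Omega(X)\}$, associated to $\phi$) if there exist $\rho>0$ and $\overline W$ with $\|\overline W\|\le1$ such that $$\rho\overline X\in\partial(\widehat\Psi\circ\sigma)(\overline W)\quad\text{and}\quad 0\in\nu\,\partial f(\overline X)+\mathcal{N}_\Omega(\overline X)+\rho\big[\partial\|\cdot\|_*(\overline X)-\overline W\big].$$ It is called a DC-stationary point (associated to $\phi$) if there exists $\rho>0$ such that $$0\in\nu\,\partial f(\overline X)+\mathcal{N}_\Omega(\overline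 X)+\rho\,\partial\|\cdot\|_*(\overline X)-\rho\,\partial(\widehat\Psi^*\circ\sigma)(\rho\overline X).$$ **Theorem.** Let $\phi\in\mathscr{L}$ and $\overline X\in\mathbb{R}^{m\times n}$. (i) Suppose that $\partial\psi(0)\cap\mathbb{R}_+=\partial\widehat\psi(0)\cap\mathbb{R}_+$, that $\widehat\psi^*:\mathbb{R}\to\mathbb{R}$ is differentiable at every $s\ge0$, and that $\psi^*$ is differentiable at $0$ with $(\psi^*)'(0)=(\widehat\psi^*)'(0)$. If $\overline X$ is a DC-stationary point associated to $\phi$, then $\overline X$ is an EP-stationary point associated to $\phi$. (ii) Conversely, suppose that $\phi$ is nondecreasing on $[0,1]$. If $\overline X$ is an EP-stationary point associated to $\phi$, then $\overline X$ is a DC-stationary point associated to $\phi$. -/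

import Mathlib

open Set Filter Topology
open scoped Pointwise

attribute [local instance] Matrix.frobeniusNormedAddCommGroup Matrix.frobeniusNormedSpace

noncomputable section

namespace RankReg

/-- The space of real `m × n` matrices; its norm is the Frobenius norm. -/
abbrev Mat (m n : ℕ) : Type := Matrix (Fin m) (Fin n) ℝ

/-- The trace inner product `⟨X, Y⟩ = tr (Xᵀ Y)`, which induces the Frobenius norm. -/
instance instInnerProductSpaceMat (m n : ℕ) : InnerProductSpace ℝ (Mat m n) where
  inner X Y := (X.transpose * Y).trace
  norm_sq_eq_re_inner X := by
    rw [Matrix.frobenius_norm_def, ← Real.sqrt_eq_rpow, Real.sq_sqrt (by positivity)]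
    simp only [Matrix.trace, Matrix.diag, Matrix.mul_apply, Matrix.transpose_apply,
      RCLike.re_to_real, Real.rpow_two, Real.norm_eq_abs, sq_abs]
    rw [Finset.sum_comm]
    simp only [sq]
  conj_inner_symm X Y := by
    rw [← Matrix.trace_transpose (X.transpose * Y)]
    simp
  add_left X Y Z := by
    simp [Matrix.add_mul]
  smul_left X Y r := by
    simp

section VariationalAnalysis

variable {E : Type*} [NormedAddCommGroup E] [InnerProductSpace ℝ E]

/-- The regular subdifferential of an extended real-valued function: `g` is finite at `z` and
`liminf_{z' → z, z' ≠ z} (g z' - g z - ⟨v, z' - z⟩) / ‖z' - z‖ ≥ 0`, in `ε`-form. -/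
def regSubdiff (g : E → EReal) (z : E) : Set E :=
  {v | g z ≠ ⊤ ∧ g z ≠ ⊥ ∧ ∀ ε : ℝ, 0 < ε → ∀ᶠ z' in 𝓝 z,
    (((g z).toReal + inner ℝ v (z' - z) - ε * ‖z' - z‖ : ℝ) : EReal) ≤ g z'}

/-- The limiting subdifferential of an extended real-valued function at a point where it is
finite (empty at the other points). -/
def limSubdiff (g : E → EReal) (z : E) : Set E :=
  {v | g z ≠ ⊤ ∧ g z ≠ ⊥ ∧ ∃ (zs vs : ℕ → E),
    Tendsto zs atTop (𝓝 z) ∧ Tendsto (fun k => g (zs k)) atTop (𝓝 (g z)) ∧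
    Tendsto vs atTop (𝓝 v) ∧ ∀ k, vs k ∈ regSubdiff g (zs k)}

/-- The regular normal cone to `S` at `z ∈ S` (empty if `z ∉ S`):
`limsup_{z' → z, z' ∈ S} ⟨v, z' - z⟩ / ‖z' - z‖ ≤ 0`, in `ε`-form. -/
def regNormalCone (S : Set E) (z : E) : Set E :=
  {v | z ∈ S ∧ ∀ ε : ℝ, 0 < ε → ∀ᶠ z' in 𝓝[S] z, inner ℝ v (z' - z) ≤ ε * ‖z' - z‖}

/-- The limiting normal cone to `S` at `z ∈ S` (empty if `z ∉ S`). -/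
def normalCone (S : Set E) (z : E) : Set E :=
  {v | z ∈ S ∧ ∃ (zs vs : ℕ → E), (∀ k, zs k ∈ S) ∧
    Tendsto zs atTop (𝓝 z) ∧ Tendsto vs atTop (𝓝 v) ∧ ∀ k, vs k ∈ regNormalCone S (zs k)}

/-- The conjugate function `g*(s) = sup_x (⟨s, x⟩ - g x)`. -/
def conjugate (g : E → EReal) (s : E) : EReal :=
  ⨆ x : E, ((inner ℝ s x : ℝ) : EReal) - g x

end VariationalAnalysis

/-- An extended real-valued function on the line is finite near `s` and has the (two-sided)
derivative `d` at `s`. -/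
def HasDerivAtE (g : ℝ → EReal) (d s : ℝ) : Prop :=
  (∀ᶠ t in 𝓝 s, g t ≠ ⊤ ∧ g t ≠ ⊥) ∧ HasDerivAt (fun t => (g t).toReal) d s

/-- The family `𝓛` of proper lsc convex functions `φ : ℝ → (-∞, +∞]` with
`int (dom φ) ⊇ [0,1]`, `φ 1 = 1` and minimal value `0` over `[0,1]`, attained at some `t* < 1`. -/
structure PenaltyFamily (φ : ℝ → EReal) : Prop where
  ne_bot : ∀ t, φ t ≠ ⊥
  proper : ∃ t, φ t ≠ ⊤
  lsc : LowerSemicontinuous φ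
  convex_epi : Convex ℝ {p : ℝ × ℝ | φ p.1 ≤ (p.2 : EReal)}
  dom : Icc (0 : ℝ) 1 ⊆ interior {t | φ t ≠ ⊤}
  one : φ 1 = 1
  argmin : ∃ t : ℝ, 0 ≤ t ∧ t < 1 ∧ IsMinOn φ (Icc 0 1) t ∧ φ t = 0

open Classical in
/-- `ψ = φ` on `[0,1]` and `ψ = +∞` elsewhere. -/
def psi (φ : ℝ → EReal) (t : ℝ) : EReal := if t ∈ Icc (0 : ℝ) 1 then φ t else ⊤

/-- `ψ̂ t = ψ |t|`. -/
def psiHat (φ : ℝ → EReal) (t : ℝ) : EReal := psi φ |t|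

/-- `Ψ̂ x = ∑ i, ψ̂ (x i)` on `ℝ^m`. -/
def PsiHat {m : ℕ} (φ : ℝ → EReal) (x : EuclideanSpace ℝ (Fin m)) : EReal :=
  ∑ i, psiHat φ (x i)

/-- The vector of the `m` largest singular values of an `m × n` matrix (all of them when
`m ≤ n`), in nonincreasing order. -/
def sigma {m n : ℕ} (X : Mat m n) : EuclideanSpace ℝ (Fin m) :=
  WithLp.toLp 2 fun i => (Matrix.toEuclideanLin X).singularValues (i : ℕ)

/-- The nuclear norm. -/
def nuclearNorm {m n : ℕ} (X : Mat m n) : ℝ := ∑ i, sigma X i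

/-- The unit ball of the spectral norm, i.e. of the operator norm `ℝⁿ → ℝᵐ`. -/
def spectralBall (m n : ℕ) : Set (Mat m n) :=
  {W | ‖LinearMap.toContinuousLinearMap (Matrix.toEuclideanLin W)‖ ≤ 1}

/-- `X` is an EP-stationary point of `min ν f(X) + rank X + δ_Ω(X)` associated to `φ`. -/
def IsEPStationary {m n : ℕ} (ν : ℝ) (f : Mat m n → ℝ) (Ω : Set (Mat m n)) (φ : ℝ → EReal)
    (X : Mat m n) : Prop :=
  ∃ ρ : ℝ, 0 < ρ ∧ ∃ W ∈ spectralBall m n,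
    ρ • X ∈ limSubdiff (fun Z : Mat m n => PsiHat φ (sigma Z)) W ∧
    (0 : Mat m n) ∈ ν • limSubdiff (fun Z : Mat m n => ((f Z : ℝ) : EReal)) X + normalCone Ω X
      + ρ • (limSubdiff (fun Z : Mat m n => ((nuclearNorm Z : ℝ) : EReal)) X - {W})

/-- `X` is a DC-stationary point of `min ν f(X) + rank X + δ_Ω(X)` associated to `φ`. -/
def IsDCStationary {m n : ℕ} (ν : ℝ) (f : Mat m n → ℝ) (Ω : Set (Mat m n)) (φ : ℝ → EReal)
    (X : Mat m n) : Prop :=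
  ∃ ρ : ℝ, 0 < ρ ∧
    (0 : Mat m n) ∈ ν • limSubdiff (fun Z : Mat m n => ((f Z : ℝ) : EReal)) X + normalCone Ω X
      + ρ • limSubdiff (fun Z : Mat m n => ((nuclearNorm Z : ℝ) : EReal)) X
      - ρ • limSubdiff (fun Z : Mat m n => conjugate (PsiHat φ) (sigma Z)) (ρ • X)

/-- `∂ψ(0)` and `∂ψ̂(0)` have the same nonnegative elements, `ψ̂*` is differentiable at every
`s ≥ 0`, and `(ψ*)'(0) = (ψ̂*)'(0)`. -/
structure ConjugateCondition (φ : ℝ → EReal) : Prop where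
  subdiff_eq : limSubdiff (psi φ) 0 ∩ Ici 0 = limSubdiff (psiHat φ) 0 ∩ Ici 0
  differentiable : ∀ s : ℝ, 0 ≤ s → ∃ d, HasDerivAtE (conjugate (psiHat φ)) d s
  deriv_eq : ∃ d, HasDerivAtE (conjugate (psi φ)) d 0 ∧ HasDerivAtE (conjugate (psiHat φ)) d 0

end RankReg

end

/-! Write F = `PsiHat φ ∘ sigma` and G = `conjugate (PsiHat φ) ∘ sigma`. Both stationarity
conditions have the same shape; one asks for ρX ∈ ∂F(W), the other for W ∈ ∂G(ρX). So everything
reduces to inverting subgradients between F and G. Von Neumann's trace inequality, with equality for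
matrices sharing singular bases, makes G the Fenchel conjugate of F on matrices: `inner_le_add` is
Fenchel–Young and `exists_inner_eq_add` says that the supremum is attained. Either inclusion follows
once equality holds in Fenchel–Young, since equality makes each matrix a global subgradient at the
other. From W ∈ ∂G(Y): G is convex, so W is a global subgradient. Testing with matrices sharing the
bases of W shows that each σ_i(W) is a subgradient of ψ̂* at σ_i(Y). Differentiability leaves only
one, and the maximizer in [0,1] defining ψ̂*(σ_i(Y)) is also one, so σ_i(W) is that maximizer and
equality holds. No convexity of F is needed. From Y ∈ ∂F(W): F can fail to be convex in general, but
when φ is nondecreasing on [0,1] it has an affine minorant exact at each point of its domain. Hence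
limiting subgradients are global, which forces equality. -/

namespace RankReg

/-! ### Singular values and von Neumann's trace inequality. -/

section Matrices

variable {m n : ℕ}

lemma sum_fin_eq_sum_castLE {M : Type*} [AddCommMonoid M] (hmn : m ≤ n) (g : Fin n → M) (hg : ∀ i : Fin n, m ≤ i → g i = 0) :
    ∑ i, g i = ∑ i : Fin m, g (Fin.castLE hmn i) := by
  symm
  change ∑ i : Fin m, g (Fin.castLEEmb hmn i) = _
  rw [← Finset.sum_map Finset.univ (Fin.castLEEmb hmn) g]
  refine Finset.sum_subset (Finset.subset_univ _) fun i _ hi => hg i ?_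
  by_contra! h
  exact hi (Finset.mem_map.2 ⟨⟨i, h⟩, Finset.mem_univ _, rfl⟩)

lemma sum_castLE_eq_of_map_eq (hmn : m ≤ n) {a b : Fin n → ℝ}
    (hab : Finset.univ.val.map a = Finset.univ.val.map b)
    (ha : ∀ i : Fin n, m ≤ i → a i = 0) (hb : ∀ i : Fin n, m ≤ i → b i = 0) (F : ℝ → ℝ) :
    ∑ i : Fin m, F (a (Fin.castLE hmn i)) = ∑ i : Fin m, F (b (Fin.castLE hmn i)) := by
  -- Subtracting `F 0` makes the zero entries of index at least `m` contribute nothing, so the sums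
  -- restrict to `Fin m`.
  have h1 : ∑ i, (F (a i) - F 0) = ∑ i, (F (b i) - F 0) := by
    have := congrArg (fun s => (s.map fun x => F x - F 0).sum) hab
    simpa only [Multiset.map_map, Finset.sum_eq_multiset_sum, Function.comp_def] using this
  rw [sum_fin_eq_sum_castLE hmn _ (by intro i hi; simp [ha i hi]),
    sum_fin_eq_sum_castLE hmn _ (by intro i hi; simp [hb i hi])] at h1
  simpa [Finset.sum_sub_distrib] using h1

/-- The extension by zero to `Fin n` of a family of vectors indexed by `Fin m`. -/
def extendZero {M : Type*} [Zero M] (u : Fin m → M) (i : Fin n) : M :=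
  if h : (i : ℕ) < m then u ⟨i, h⟩ else 0

@[simp] lemma extendZero_castLE {M : Type*} [Zero M] (hmn : m ≤ n) (u : Fin m → M) (i : Fin m) :
    extendZero u (Fin.castLE hmn i) = u i := by
  simp [extendZero]

lemma extendZero_of_le {M : Type*} [Zero M] (u : Fin m → M) {i : Fin n} (hi : m ≤ i) :
    extendZero u i = 0 := by
  simp [extendZero, hi]

lemma singularValues_eq_zero_of_le
    (T : EuclideanSpace ℝ (Fin n) →ₗ[ℝ] EuclideanSpace ℝ (Fin m)) {i : ℕ} (hi : m ≤ i) :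
    T.singularValues i = 0 := by
  rw [LinearMap.singularValues_eq_zero_iff_le_finrank_range]
  refine le_trans ?_ hi
  simpa using T.range.finrank_le

/-- Eigenvectors of T*T serve as right singular vectors: their images under T are orthogonal, with
squared norms the eigenvalues. -/
lemma inner_apply_eigenvectorBasis
    (T : EuclideanSpace ℝ (Fin n) →ₗ[ℝ] EuclideanSpace ℝ (Fin m)) (i j : Fin n) :
    inner ℝ (T (T.isSymmetric_adjoint_comp_self.eigenvectorBasis finrank_euclideanSpace_fin i))
      (T (T.isSymmetric_adjoint_comp_self.eigenvectorBasis finrank_euclideanSpace_fin j)) =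
      if i = j then T.singularValues i ^ 2 else 0 := by
  set v := T.isSymmetric_adjoint_comp_self.eigenvectorBasis finrank_euclideanSpace_fin with hv
  rw [← LinearMap.adjoint_inner_left, ← LinearMap.comp_apply,
    hv, LinearMap.IsSymmetric.apply_eigenvectorBasis, ← hv, inner_smul_left,
    OrthonormalBasis.inner_eq_ite, T.sq_singularValues_fin finrank_euclideanSpace_fin]
  simp

/-- Singular value decomposition. -/
lemma exists_svd (hmn : m ≤ n)
    (T : EuclideanSpace ℝ (Fin n) →ₗ[ℝ] EuclideanSpace ℝ (Fin m)) :
    ∃ (v : OrthonormalBasis (Fin n) ℝ (EuclideanSpace ℝ (Fin n)))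
      (u : OrthonormalBasis (Fin m) ℝ (EuclideanSpace ℝ (Fin m))),
      ∀ i : Fin n, T (v i) = T.singularValues i • extendZero u i := by
  set v := T.isSymmetric_adjoint_comp_self.eigenvectorBasis finrank_euclideanSpace_fin with hv
  have hin := inner_apply_eigenvectorBasis T
  rw [← hv] at hin
  -- Normalized images are orthonormal only where the singular value is nonzero. The remaining left
  -- singular vectors come from completing this family to a basis.
  let w : Fin m → EuclideanSpace ℝ (Fin m) := fun i =>
    (T.singularValues i)⁻¹ • T (v (Fin.castLE hmn i))
  let s : Set (Fin m) := {i | T.singularValues i ≠ 0}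
  have hw : Orthonormal ℝ (s.domRestrict w) := by
    rw [orthonormal_iff_ite]
    rintro ⟨i, hi⟩ ⟨j, hj⟩
    simp only [Set.domRestrict_apply, w, inner_smul_left, inner_smul_right, hin, Subtype.mk.injEq]
    have hi' : T.singularValues i ≠ 0 := hi
    by_cases hij : i = j
    · subst hij
      simp only [if_true, Fin.val_castLE, conj_trivial]
      field_simp
    · simp [hij]
  obtain ⟨u, hu⟩ := hw.exists_orthonormalBasis_extension_of_card_eq (by simp)
  refine ⟨v, u, fun i => ?_⟩
  have h0 : T.singularValues i = 0 → T (v i) = 0 := fun h => by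
    have := hin i i
    rw [if_pos rfl, h] at this
    simpa using this
  by_cases hz : T.singularValues i = 0
  · simp [hz, h0 hz]
  · have him : (i : ℕ) < m := by
      by_contra! h
      exact hz (singularValues_eq_zero_of_le T h)
    have : u ⟨i, him⟩ = w ⟨i, him⟩ := hu _ hz
    simp only [extendZero, him, dite_true, this, w]
    rw [smul_smul, mul_inv_cancel₀ hz, one_smul]
    rfl

/-- The singular values of an operator that is diagonal with respect to orthonormal bases. -/
lemma map_singularValues_of_diagonal
    (T : EuclideanSpace ℝ (Fin n) →ₗ[ℝ] EuclideanSpace ℝ (Fin m))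
    (v : OrthonormalBasis (Fin n) ℝ (EuclideanSpace ℝ (Fin n)))
    (u : OrthonormalBasis (Fin m) ℝ (EuclideanSpace ℝ (Fin m))) (s : Fin m → ℝ)
    (hT : ∀ i : Fin n, T (v i) = (extendZero s i : ℝ) • extendZero u i) :
    (Finset.univ : Finset (Fin n)).val.map (fun i : Fin n => T.singularValues i) =
      (Finset.univ : Finset (Fin n)).val.map (fun i => |extendZero s i|) := by
  have hTT : ∀ i, (T.adjoint ∘ₗ T) (v i) = ((extendZero s i : ℝ) ^ 2) • v i := by
    intro i
    refine InnerProductSpace.ext_inner_left_basis v.toBasis fun j => ?_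
    rw [OrthonormalBasis.coe_toBasis]
    rw [LinearMap.comp_apply, LinearMap.adjoint_inner_right, hT, hT, inner_smul_left,
      inner_smul_right, inner_smul_right, OrthonormalBasis.inner_eq_ite]
    by_cases hi : (i : ℕ) < m
    · by_cases hj : (j : ℕ) < m
      · by_cases hij : j = i
        · subst hij
          simp [extendZero, hi]
          ring
        · have : (⟨j, hj⟩ : Fin m) ≠ ⟨i, hi⟩ := fun h => hij (Fin.ext (by simpa using h))
          simp [extendZero, hi, hj, hij, this]
      · have : j ≠ i := by rintro rfl; exact hj hi
        simp [extendZero, hi, hj, this]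
    · simp [extendZero, hi]
  -- The characteristic polynomial determines the eigenvalues of T*T with multiplicity; square roots
  -- then give the singular values.
  have hch : (T.adjoint ∘ₗ T).charpoly =
      ∏ i : Fin n, (Polynomial.X - Polynomial.C ((extendZero s i : ℝ) ^ 2)) := by
    rw [← LinearMap.charpoly_toMatrix _ v.toBasis, ← Matrix.charpoly_diagonal]
    congr 1
    ext i j
    rw [LinearMap.toMatrix_apply, OrthonormalBasis.coe_toBasis, hTT]
    by_cases h : i = j
    · subst h; simp [OrthonormalBasis.repr_self]
    · simp [OrthonormalBasis.repr_self, h]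
  have hr := T.isSymmetric_adjoint_comp_self.roots_charpoly_eq_eigenvalues
    finrank_euclideanSpace_fin
  rw [hch, Polynomial.roots_prod _ _ (by
    rw [Finset.prod_ne_zero_iff]; intro i _; exact Polynomial.X_sub_C_ne_zero _)] at hr
  simp only [Polynomial.roots_X_sub_C, Multiset.bind_singleton] at hr
  have h2 := congrArg (Multiset.map Real.sqrt) hr
  simp only [Multiset.map_map, Function.comp_def, Real.sqrt_sq_eq_abs, RCLike.ofReal_real_eq_id,
    id] at h2
  rw [h2]
  refine Multiset.map_congr rfl fun i _ => ?_
  rw [T.singularValues_fin finrank_euclideanSpace_fin]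

/-- The sum is the trace of X*Y, which does not depend on the orthonormal basis. -/
lemma inner_eq_sum_inner_apply (X Y : Mat m n)
    (b : OrthonormalBasis (Fin n) ℝ (EuclideanSpace ℝ (Fin n))) :
    inner ℝ X Y =
      ∑ i, inner ℝ (Matrix.toEuclideanLin X (b i)) (Matrix.toEuclideanLin Y (b i)) := by
  have key : ∀ b : OrthonormalBasis (Fin n) ℝ (EuclideanSpace ℝ (Fin n)),
      ∑ i, inner ℝ (Matrix.toEuclideanLin X (b i)) (Matrix.toEuclideanLin Y (b i)) =
      LinearMap.trace ℝ _ ((Matrix.toEuclideanLin X).adjoint ∘ₗ Matrix.toEuclideanLin Y) := by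
    intro b
    rw [LinearMap.trace_eq_sum_inner _ b]
    exact Finset.sum_congr rfl fun i _ => by
      rw [LinearMap.comp_apply, LinearMap.adjoint_inner_right]
  rw [key, ← key (EuclideanSpace.basisFun _ _)]
  change (X.transpose * Y).trace = _
  simp only [Matrix.trace, Matrix.diag, Matrix.mul_apply, Matrix.transpose_apply]
  refine Finset.sum_congr rfl fun i _ => ?_
  simp [PiLp.inner_apply, Matrix.toLpLin_apply, mul_comm]

/-- By Birkhoff's theorem `A` is a convex combination of permutation matrices, and each of these
obeys the rearrangement inequality. -/
lemma sum_mul_le_of_doublyStochastic {k : ℕ} {A : Matrix (Fin k) (Fin k) ℝ}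
    (hA : A ∈ doublyStochastic ℝ (Fin k)) {a b : Fin k → ℝ} (ha : Antitone a) (hb : Antitone b) :
    ∑ i, ∑ j, a i * b j * A i j ≤ ∑ i, a i * b i := by
  obtain ⟨w, hw0, hw1, rfl⟩ := exists_eq_sum_perm_of_mem_doublyStochastic hA
  have h1 : ∀ π : Equiv.Perm (Fin k),
      ∑ i, ∑ j, a i * b j * (π.permMatrix ℝ) i j = ∑ i, a i * b (π i) := by
    intro π
    refine Finset.sum_congr rfl fun i _ => ?_
    simp [Equiv.Perm.permMatrix, PEquiv.toMatrix_apply, eq_comm]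
  have h2 : ∑ i, ∑ j, a i * b j * (∑ π, w π • π.permMatrix ℝ) i j =
      ∑ π, w π * ∑ i, ∑ j, a i * b j * (π.permMatrix ℝ) i j := by
    simp only [Matrix.sum_apply, Matrix.smul_apply, smul_eq_mul, Finset.mul_sum]
    rw [Finset.sum_comm' (t' := Finset.univ) (s' := fun _ => Finset.univ) (by simp)]
    conv_rhs => rw [Finset.sum_comm]
    rw [Finset.sum_comm]
    refine Finset.sum_congr rfl fun i _ => ?_
    rw [Finset.sum_comm]
    exact Finset.sum_congr rfl fun π _ => Finset.sum_congr rfl fun j _ => by ring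
  rw [h2]
  calc ∑ π, w π * ∑ i, ∑ j, a i * b j * (π.permMatrix ℝ) i j
      ≤ ∑ π, w π * ∑ i, a i * b i := Finset.sum_le_sum fun π _ => by
        rw [h1]
        exact mul_le_mul_of_nonneg_left ((ha.monovary hb).sum_mul_comp_perm_le_sum_mul) (hw0 π)
    _ = ∑ i, a i * b i := by rw [← Finset.sum_mul, hw1, one_mul]

lemma inner_sq_mem_doublyStochastic {k : ℕ}
    (b c : OrthonormalBasis (Fin k) ℝ (EuclideanSpace ℝ (Fin k))) :
    (Matrix.of fun i j => (inner ℝ (b i) (c j) : ℝ) ^ 2) ∈ doublyStochastic ℝ (Fin k) := by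
  rw [mem_doublyStochastic_iff_sum]
  refine ⟨fun i j => sq_nonneg _, fun i => ?_, fun j => ?_⟩
  · have := c.sum_sq_norm_inner_left (b i)
    simpa [b.norm_eq_one] using this
  · have := b.sum_sq_norm_inner_right (c j)
    simpa [c.norm_eq_one] using this

lemma sigma_nonneg (X : Mat m n) (i : Fin m) : 0 ≤ sigma X i :=
  LinearMap.singularValues_nonneg _ _

/-- Von Neumann's trace inequality. -/
lemma inner_le_sum_sigma_mul_sigma (hmn : m ≤ n) (X Y : Mat m n) :
    inner ℝ X Y ≤ ∑ i, sigma X i * sigma Y i := by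
  obtain ⟨v, u, hv⟩ := exists_svd hmn (Matrix.toEuclideanLin X)
  obtain ⟨q, p, hq⟩ := exists_svd hmn (Matrix.toEuclideanLin Y)
  set S := (Matrix.toEuclideanLin X).singularValues with hS
  set R := (Matrix.toEuclideanLin Y).singularValues with hR
  have hSa : Antitone S := (Matrix.toEuclideanLin X).singularValues_antitone
  have hRa : Antitone R := (Matrix.toEuclideanLin Y).singularValues_antitone
  have hS0 : ∀ i, 0 ≤ S i := (Matrix.toEuclideanLin X).singularValues_nonneg
  have hR0 : ∀ i, 0 ≤ R i := (Matrix.toEuclideanLin Y).singularValues_nonneg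
  have hSz : ∀ i : Fin n, m ≤ i → S i = 0 := fun i => singularValues_eq_zero_of_le _
  have hRz : ∀ i : Fin n, m ≤ i → R i = 0 := fun i => singularValues_eq_zero_of_le _
  have e1 : inner ℝ X Y = ∑ i : Fin n, ∑ j : Fin n,
      S i * R j * (inner ℝ (v i) (q j) * inner ℝ (extendZero u i) (extendZero p j)) := by
    rw [inner_eq_sum_inner_apply X Y v]
    refine Finset.sum_congr rfl fun i _ => ?_
    have : Matrix.toEuclideanLin Y (v i) =
        ∑ j, (inner ℝ (q j) (v i) : ℝ) • (R j • extendZero p j) := by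
      conv_lhs => rw [← q.sum_repr' (v i)]
      simp [map_sum, hq]
    rw [this, hv, inner_sum]
    refine Finset.sum_congr rfl fun j _ => ?_
    rw [inner_smul_left, inner_smul_right, inner_smul_right, real_inner_comm (v i)]
    simp only [conj_trivial]
    ring
  have e2 : ∑ i : Fin n, ∑ j : Fin n, S i * R j * (inner ℝ (v i) (q j) : ℝ) ^ 2 ≤
      ∑ i : Fin n, S i * R i :=
    sum_mul_le_of_doublyStochastic (inner_sq_mem_doublyStochastic v q)
      (a := fun i => S i) (b := fun i => R i) (fun i j h => hSa h) (fun i j h => hRa h)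
  have e3 : ∑ i : Fin n, ∑ j : Fin n, S i * R j *
      (inner ℝ (extendZero u i) (extendZero p j) : ℝ) ^ 2 ≤ ∑ i : Fin m, S i * R i := by
    rw [sum_fin_eq_sum_castLE hmn _ fun i hi => by simp [hSz i hi]]
    refine le_trans (le_of_eq (Finset.sum_congr rfl fun i _ => ?_))
      (sum_mul_le_of_doublyStochastic (inner_sq_mem_doublyStochastic u p)
      (a := fun i => S i) (b := fun i => R i) (fun i j h => hSa h) (fun i j h => hRa h))
    rw [sum_fin_eq_sum_castLE hmn _ fun i hi => by simp [hRz i hi]]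
    simp
  rw [sum_fin_eq_sum_castLE hmn (fun i : Fin n => S i * R i) fun i hi => by
    simp [hSz i hi]] at e2
  -- The inequality 2ab ≤ a² + b² separates left from right singular vectors; the squared inner
  -- products of each kind form a doubly stochastic matrix.
  have e4 : inner ℝ X Y ≤
      (∑ i : Fin n, ∑ j : Fin n, S i * R j * (inner ℝ (v i) (q j) : ℝ) ^ 2 +
       ∑ i : Fin n, ∑ j : Fin n, S i * R j *
        (inner ℝ (extendZero u i) (extendZero p j) : ℝ) ^ 2) / 2 := by
    rw [e1, ← Finset.sum_add_distrib, Finset.sum_div]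
    refine Finset.sum_le_sum fun i _ => ?_
    rw [← Finset.sum_add_distrib, Finset.sum_div]
    refine Finset.sum_le_sum fun j _ => ?_
    have := mul_le_mul_of_nonneg_left (two_mul_le_add_sq (inner ℝ (v i) (q j) : ℝ)
      (inner ℝ (extendZero u i) (extendZero p j))) (mul_nonneg (hS0 i) (hR0 j))
    linarith
  refine e4.trans ?_
  have e5 : ∑ i : Fin m, S i * R i = ∑ i, sigma X i * sigma Y i := rfl
  simp only [Fin.val_castLE] at e2
  linarith

/-- For every matrix `X` and vector `s` there is a matrix with a singular value decomposition in
the same bases as `X` and with diagonal `s`. -/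
lemma exists_simultaneous_svd (hmn : m ≤ n) (X : Mat m n) (s : Fin m → ℝ) :
    ∃ Z : Mat m n, inner ℝ X Z = ∑ i, sigma X i * s i ∧
      ∀ F : ℝ → ℝ, ∑ i, F (sigma Z i) = ∑ i, F |s i| := by
  obtain ⟨v, u, hv⟩ := exists_svd hmn (Matrix.toEuclideanLin X)
  let T : EuclideanSpace ℝ (Fin n) →ₗ[ℝ] EuclideanSpace ℝ (Fin m) :=
    v.toBasis.constr ℝ fun i => (extendZero s i : ℝ) • extendZero u i
  have hT : ∀ i : Fin n, T (v i) = (extendZero s i : ℝ) • extendZero u i := fun i => by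
    have := v.toBasis.constr_basis ℝ
      (fun i => (extendZero s i : ℝ) • (extendZero u i : EuclideanSpace ℝ (Fin m))) i
    rwa [OrthonormalBasis.coe_toBasis] at this
  refine ⟨Matrix.toEuclideanLin.symm T, ?_, fun F => ?_⟩
  · rw [inner_eq_sum_inner_apply _ _ v]
    simp only [LinearEquiv.apply_symm_apply, hv, hT]
    rw [sum_fin_eq_sum_castLE hmn _ fun i hi => by simp [extendZero_of_le _ hi]]
    refine Finset.sum_congr rfl fun i _ => ?_
    simp [inner_smul_left, inner_smul_right, sigma, mul_comm]
  · have := sum_castLE_eq_of_map_eq hmn (a := fun i : Fin n => T.singularValues i) (map_singularValues_of_diagonal T v u s hT)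
      (fun i => singularValues_eq_zero_of_le _) (fun i hi => by simp [extendZero_of_le _ hi]) F
    simpa [sigma] using this

lemma mem_spectralBall_of_sigma_le_one (hmn : m ≤ n) {W : Mat m n} (hW : ∀ i, sigma W i ≤ 1) :
    W ∈ spectralBall m n := by
  obtain ⟨v, u, hv⟩ := exists_svd hmn (Matrix.toEuclideanLin W)
  refine ContinuousLinearMap.opNorm_le_bound _ zero_le_one fun x => ?_
  rw [one_mul, LinearMap.coe_toContinuousLinearMap']
  have h1 : Matrix.toEuclideanLin W x =
      ∑ i : Fin m, ((inner ℝ (v (Fin.castLE hmn i)) x : ℝ) * sigma W i) • u i := by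
    conv_lhs => rw [← v.sum_repr' x]
    simp only [map_sum, map_smul, hv]
    rw [sum_fin_eq_sum_castLE hmn _ fun i hi => by simp [extendZero_of_le _ hi]]
    simp [sigma, smul_smul]
  have h2 : ∀ i, inner ℝ (u i) (Matrix.toEuclideanLin W x) =
      (inner ℝ (v (Fin.castLE hmn i)) x : ℝ) * sigma W i := fun i => by
    rw [h1, inner_sum]
    simp [inner_smul_right, OrthonormalBasis.inner_eq_ite]
  refine le_of_sq_le_sq ?_ (norm_nonneg x)
  rw [← u.sum_sq_norm_inner_right, ← v.sum_sq_norm_inner_right]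
  calc ∑ i, ‖inner ℝ (u i) (Matrix.toEuclideanLin W x)‖ ^ 2
      ≤ ∑ i : Fin m, ‖(inner ℝ (v (Fin.castLEEmb hmn i)) x : ℝ)‖ ^ 2 :=
        Finset.sum_le_sum fun i _ => by
          rw [h2, norm_mul, mul_pow]
          refine mul_le_of_le_one_right (sq_nonneg _) (pow_le_one₀ (norm_nonneg _) ?_)
          rw [Real.norm_of_nonneg (sigma_nonneg W i)]
          exact hW i
    _ = ∑ i ∈ Finset.univ.map (Fin.castLEEmb hmn), ‖(inner ℝ (v i) x : ℝ)‖ ^ 2 :=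
        (Finset.sum_map Finset.univ (Fin.castLEEmb hmn)
          fun i => ‖(inner ℝ (v i) x : ℝ)‖ ^ 2).symm
    _ ≤ ∑ i, ‖(inner ℝ (v i) x : ℝ)‖ ^ 2 :=
        Finset.sum_le_sum_of_subset_of_nonneg (Finset.subset_univ _) fun i _ _ => sq_nonneg _

end Matrices


/-! ### Global, regular and limiting subgradients. -/

section Subdifferentials

variable {E : Type*} [NormedAddCommGroup E] [InnerProductSpace ℝ E]

/-- Global subgradients are regular, and constant sequences make them limiting; no convexity is
needed. -/
lemma mem_limSubdiff_of_forall_le {g : E → EReal} {z v : E} {c : ℝ} (hz : g z = c)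
    (h : ∀ z', ((c + inner ℝ v (z' - z) : ℝ) : EReal) ≤ g z') : v ∈ limSubdiff g z := by
  have h1 : g z ≠ ⊤ := by simp [hz]
  have h2 : g z ≠ ⊥ := by simp [hz]
  refine ⟨h1, h2, fun _ => z, fun _ => v, tendsto_const_nhds, tendsto_const_nhds,
    tendsto_const_nhds, fun _ => ⟨h1, h2, fun ε hε => Eventually.of_forall fun z' => ?_⟩⟩
  refine le_trans (EReal.coe_le_coe_iff.2 ?_) (h z')
  rw [hz, EReal.toReal_coe]
  have := mul_nonneg hε.le (norm_nonneg (z' - z))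
  linarith

/-- If `g` has a global affine minorant at every point of its convex domain, then every regular
subgradient of `g` is global. -/
lemma le_of_mem_regSubdiff {g : E → EReal} {D : Set E} {r : E → ℝ} (hD : Convex ℝ D)
    (hgD : ∀ z ∈ D, g z = r z) (hgt : ∀ z ∉ D, g z = ⊤)
    (hsub : ∀ z ∈ D, ∃ y : E, ∀ z' ∈ D, r z + inner ℝ y (z' - z) ≤ r z') {z v : E}
    (hv : v ∈ regSubdiff g z) : z ∈ D ∧ ∀ z' ∈ D, r z + inner ℝ v (z' - z) ≤ r z' := by
  obtain ⟨h1, -, h3⟩ := hv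
  have hz : z ∈ D := by
    by_contra h
    exact h1 (hgt z h)
  refine ⟨hz, fun z' hz' => le_of_forall_pos_le_add fun δ hδ => ?_⟩
  have hN : 0 < ‖z' - z‖ + 1 := by positivity
  -- This ε makes the error ε‖z' - z‖ at most δ; the added 1 covers z' = z.
  have hε : 0 < δ / (‖z' - z‖ + 1) := by positivity
  have hc : Tendsto (fun t : ℝ => z + t • (z' - z)) (𝓝[>] 0) (𝓝 z) := by
    have : Continuous fun t : ℝ => z + t • (z' - z) := by fun_prop
    have h := this.tendsto 0
    simp only [zero_smul, add_zero] at h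
    exact h.mono_left nhdsWithin_le_nhds
  obtain ⟨t, ht, ht0, ht1⟩ := ((hc.eventually (h3 _ hε)).and
    (Ioo_mem_nhdsGT (zero_lt_one' ℝ))).exists
  have hw : z + t • (z' - z) ∈ D := hD.add_smul_sub_mem hz hz' ⟨ht0.le, ht1.le⟩
  rw [hgD _ hz, hgD _ hw, EReal.toReal_coe, EReal.coe_le_coe_iff, add_sub_cancel_left,
    inner_smul_right, norm_smul, Real.norm_of_nonneg ht0.le] at ht
  obtain ⟨y, hy⟩ := hsub _ hw
  have a1 := hy z hz
  have a2 := hy z' hz'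
  have e1 : z - (z + t • (z' - z)) = (-t) • (z' - z) := by module
  have e2 : z' - (z + t • (z' - z)) = (1 - t) • (z' - z) := by module
  rw [e1, inner_smul_right] at a1
  rw [e2, inner_smul_right] at a2
  -- Weighting the minorants at z and z' by 1 - t and t cancels `y`, leaving convexity along the
  -- segment.
  have a3 : r (z + t • (z' - z)) ≤ (1 - t) * r z + t * r z' := by
    have b1 := mul_le_mul_of_nonneg_left a1 (sub_nonneg.2 ht1.le)
    have b2 := mul_le_mul_of_nonneg_left a2 ht0.le
    linear_combination b1 + b2
  have a4 : t * (r z + inner ℝ v (z' - z)) ≤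
      t * (r z' + δ / (‖z' - z‖ + 1) * ‖z' - z‖) := by
    linear_combination ht + a3
  refine (le_of_mul_le_mul_left a4 ht0).trans ?_
  gcongr
  rw [div_mul_eq_mul_div, div_le_iff₀ hN]
  nlinarith [norm_nonneg (z' - z)]

/-- If `g` has a global affine minorant at every point of its convex domain, then every limiting
subgradient of `g` is global. -/
lemma le_of_mem_limSubdiff {g : E → EReal} {D : Set E} {r : E → ℝ} (hD : Convex ℝ D)
    (hgD : ∀ z ∈ D, g z = r z) (hgt : ∀ z ∉ D, g z = ⊤)
    (hsub : ∀ z ∈ D, ∃ y : E, ∀ z' ∈ D, r z + inner ℝ y (z' - z) ≤ r z') {z v : E}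
    (hv : v ∈ limSubdiff g z) : z ∈ D ∧ ∀ z' ∈ D, r z + inner ℝ v (z' - z) ≤ r z' := by
  obtain ⟨h1, -, zs, vs, hzs, hgs, hvs, hreg⟩ := hv
  have hz : z ∈ D := by
    by_contra h
    exact h1 (hgt z h)
  have hk := fun k => le_of_mem_regSubdiff hD hgD hgt hsub (hreg k)
  refine ⟨hz, fun z' hz' => ?_⟩
  have hr : Tendsto (fun k => r (zs k)) atTop (𝓝 (r z)) := by
    rw [hgD z hz] at hgs
    simp only [hgD _ (hk _).1] at hgs
    exact EReal.tendsto_coe.1 hgs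
  have hi : Tendsto (fun k => (inner ℝ (vs k) (z' - zs k) : ℝ)) atTop
      (𝓝 (inner ℝ v (z' - z))) := hvs.inner (tendsto_const_nhds.sub hzs)
  exact le_of_tendsto (hr.add hi) (Eventually.of_forall fun k => (hk k).2 z' hz')

end Subdifferentials

/-! ### The scalar penalty, its conjugate, and their spectral lifts. -/

section Penalty

variable {φ : ℝ → EReal}

/-- The real-valued restriction of an extended real-valued penalty to its domain. -/
noncomputable def penaltyReal (φ : ℝ → EReal) (t : ℝ) : ℝ := (φ t).toReal

/-- The conjugate of `psiHat φ` as a real-valued function. -/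
noncomputable def conjReal (φ : ℝ → EReal) (s : ℝ) : ℝ :=
  sSup ((fun t => |s| * t - penaltyReal φ t) '' Icc 0 1)

lemma PenaltyFamily.coe_penaltyReal (hφ : PenaltyFamily φ) {t : ℝ} (ht : φ t ≠ ⊤) :
    φ t = penaltyReal φ t :=
  (EReal.coe_toReal ht (hφ.ne_bot t)).symm

lemma PenaltyFamily.convexOn (hφ : PenaltyFamily φ) :
    ConvexOn ℝ {t | φ t ≠ ⊤} (penaltyReal φ) := by
  have key : ∀ ⦃x⦄, φ x ≠ ⊤ → ∀ ⦃y⦄, φ y ≠ ⊤ → ∀ ⦃a b : ℝ⦄, 0 ≤ a → 0 ≤ b → a + b = 1 →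
      φ (a • x + b • y) ≤ ((a • penaltyReal φ x + b • penaltyReal φ y : ℝ) : EReal) :=
    fun x hx y hy a b ha hb hab => hφ.convex_epi (x := (x, penaltyReal φ x))
      (hφ.coe_penaltyReal hx).le (y := (y, penaltyReal φ y)) (hφ.coe_penaltyReal hy).le ha hb hab
  have hc : Convex ℝ {t | φ t ≠ ⊤} := fun x hx y hy a b ha hb hab =>
    ((key hx hy ha hb hab).trans_lt (EReal.coe_lt_top _)).ne
  refine ⟨hc, fun x hx y hy a b ha hb hab => ?_⟩
  have h := key hx hy ha hb hab
  rwa [hφ.coe_penaltyReal (hc hx hy ha hb hab), EReal.coe_le_coe_iff] at h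

lemma PenaltyFamily.ne_top (hφ : PenaltyFamily φ) {t : ℝ} (ht : t ∈ Icc (0 : ℝ) 1) : φ t ≠ ⊤ :=
  interior_subset (hφ.dom ht)

lemma PenaltyFamily.continuousOn (hφ : PenaltyFamily φ) :
    ContinuousOn (penaltyReal φ) (Icc 0 1) :=
  hφ.convexOn.continuousOn_interior.mono hφ.dom

lemma PenaltyFamily.exists_conjReal_eq (hφ : PenaltyFamily φ) (s : ℝ) :
    ∃ t ∈ Icc (0 : ℝ) 1, conjReal φ s = |s| * t - penaltyReal φ t ∧
      ∀ t' ∈ Icc (0 : ℝ) 1, |s| * t' - penaltyReal φ t' ≤ conjReal φ s := by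
  have hc : ContinuousOn (fun t => |s| * t - penaltyReal φ t) (Icc 0 1) :=
    (continuousOn_const.mul continuousOn_id).sub hφ.continuousOn
  obtain ⟨t, ht, he, hle⟩ := isCompact_Icc.exists_sSup_image_eq_and_ge
    (nonempty_Icc.2 zero_le_one) hc
  exact ⟨t, ht, he, fun t' ht' => (hle t' ht').trans_eq he.symm⟩

lemma PenaltyFamily.mul_sub_le_conjReal (hφ : PenaltyFamily φ) (s : ℝ) {t : ℝ}
    (ht : t ∈ Icc (0 : ℝ) 1) : |s| * t - penaltyReal φ t ≤ conjReal φ s := by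
  obtain ⟨_, _, _, h⟩ := hφ.exists_conjReal_eq s
  exact h t ht

@[simp] lemma conjReal_abs (s : ℝ) : conjReal φ |s| = conjReal φ s := by
  simp [conjReal]

lemma PenaltyFamily.psiHat_of_abs_le (hφ : PenaltyFamily φ) {t : ℝ} (ht : |t| ≤ 1) :
    psiHat φ t = penaltyReal φ |t| := by
  have h : |t| ∈ Icc (0 : ℝ) 1 := ⟨abs_nonneg t, ht⟩
  rw [psiHat, psi, if_pos h, hφ.coe_penaltyReal (hφ.ne_top h)]

lemma psiHat_of_one_lt_abs {t : ℝ} (ht : 1 < |t|) : psiHat φ t = ⊤ :=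
  if_neg fun h => ht.not_ge h.2

lemma PenaltyFamily.psiHat_ne_bot (hφ : PenaltyFamily φ) (t : ℝ) : psiHat φ t ≠ ⊥ := by
  by_cases h : |t| ≤ 1
  · simp [hφ.psiHat_of_abs_le h]
  · simp [psiHat_of_one_lt_abs (not_le.1 h)]

/-- Since ψ̂ is even, the best x has the sign of s, so the supremum reduces to t = |x| in [0,1] with
slope |s|. -/
lemma PenaltyFamily.conjugate_psiHat (hφ : PenaltyFamily φ) (s : ℝ) :
    conjugate (psiHat φ) s = conjReal φ s := by
  apply le_antisymm
  · refine iSup_le fun x => ?_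
    by_cases h : |x| ≤ 1
    · rw [hφ.psiHat_of_abs_le h, ← EReal.coe_sub, EReal.coe_le_coe_iff]
      refine le_trans ?_ (hφ.mul_sub_le_conjReal s ⟨abs_nonneg x, h⟩)
      have := real_inner_le_norm s x
      simpa using this
    · rw [psiHat_of_one_lt_abs (not_le.1 h), EReal.sub_top]
      exact bot_le
  · obtain ⟨t, ht, he, -⟩ := hφ.exists_conjReal_eq s
    have hx : ∃ x : ℝ, |x| = t ∧ s * x = |s| * t := by
      rcases le_total 0 s with hs | hs
      · exact ⟨t, abs_of_nonneg ht.1, by rw [abs_of_nonneg hs]⟩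
      · exact ⟨-t, by rw [abs_neg, abs_of_nonneg ht.1], by rw [abs_of_nonpos hs]; ring⟩
    obtain ⟨x, hxt, hsx⟩ := hx
    refine le_iSup_of_le x ?_
    rw [hφ.psiHat_of_abs_le (hxt.trans_le ht.2), ← EReal.coe_sub, EReal.coe_le_coe_iff, he, hxt]
    simp [← hsx, mul_comm]

variable {m n : ℕ}

lemma coe_finset_sum {ι : Type*} (s : Finset ι) (f : ι → ℝ) :
    ((∑ i ∈ s, f i : ℝ) : EReal) = ∑ i ∈ s, (f i : EReal) :=
  map_sum (⟨⟨Real.toEReal, EReal.coe_zero⟩, EReal.coe_add⟩ : ℝ →+ EReal) f s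

lemma PenaltyFamily.PsiHat_of_abs_le (hφ : PenaltyFamily φ) {x : EuclideanSpace ℝ (Fin m)}
    (hx : ∀ i, |x i| ≤ 1) : PsiHat φ x = ((∑ i, penaltyReal φ |x i| : ℝ) : EReal) := by
  rw [coe_finset_sum]
  exact Finset.sum_congr rfl fun i _ => hφ.psiHat_of_abs_le (hx i)

lemma PenaltyFamily.PsiHat_of_one_lt_abs (hφ : PenaltyFamily φ) {x : EuclideanSpace ℝ (Fin m)}
    {i : Fin m} (hx : 1 < |x i|) : PsiHat φ x = ⊤ := by
  rw [PsiHat, ← Finset.add_sum_erase _ _ (Finset.mem_univ i), psiHat_of_one_lt_abs hx]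
  refine EReal.top_add_of_ne_bot ?_
  refine Finset.sum_induction _ (· ≠ ⊥) (fun a b ha hb => ?_) (by simp)
    fun j _ => hφ.psiHat_ne_bot _
  simp [EReal.add_eq_bot_iff, ha, hb]

/-- The supremum of a separable function decouples coordinate by coordinate. -/
lemma PenaltyFamily.conjugate_PsiHat (hφ : PenaltyFamily φ) (s : EuclideanSpace ℝ (Fin m)) :
    conjugate (PsiHat φ) s = ((∑ i, conjReal φ (s i) : ℝ) : EReal) := by
  apply le_antisymm
  · refine iSup_le fun x => ?_
    by_cases h : ∀ i, |x i| ≤ 1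
    · rw [hφ.PsiHat_of_abs_le h, ← EReal.coe_sub, EReal.coe_le_coe_iff, PiLp.inner_apply,
        ← Finset.sum_sub_distrib]
      refine Finset.sum_le_sum fun i _ => ?_
      refine le_trans ?_ (hφ.mul_sub_le_conjReal (s i) ⟨abs_nonneg (x i), h i⟩)
      have := real_inner_le_norm (s i) (x i)
      simpa using this
    · push Not at h
      obtain ⟨i, hi⟩ := h
      rw [hφ.PsiHat_of_one_lt_abs hi, EReal.sub_top]
      exact bot_le
  · have hx : ∀ i, ∃ x : ℝ, |x| ≤ 1 ∧ s i * x - penaltyReal φ |x| = conjReal φ (s i) := by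
      intro i
      obtain ⟨t, ht, he, -⟩ := hφ.exists_conjReal_eq (s i)
      rcases le_total 0 (s i) with hs | hs
      · refine ⟨t, (abs_of_nonneg ht.1).trans_le ht.2, ?_⟩
        rw [abs_of_nonneg ht.1, he, abs_of_nonneg hs]
      · refine ⟨-t, ((abs_neg t).trans (abs_of_nonneg ht.1)).trans_le ht.2, ?_⟩
        rw [abs_neg, abs_of_nonneg ht.1, he, abs_of_nonpos hs]
        ring
    choose x hx1 hx2 using hx
    refine le_iSup_of_le (WithLp.toLp 2 x) ?_
    rw [hφ.PsiHat_of_abs_le hx1, ← EReal.coe_sub, EReal.coe_le_coe_iff, PiLp.inner_apply,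
      ← Finset.sum_sub_distrib]
    refine Finset.sum_le_sum fun i _ => ?_
    rw [← hx2 i]
    simp [mul_comm]

/-- A subgradient of the conjugate at a point of differentiability is the derivative. -/
lemma PenaltyFamily.eq_of_hasDerivAtE (hφ : PenaltyFamily φ) {s d τ : ℝ}
    (hd : HasDerivAtE (conjugate (psiHat φ)) d s)
    (hτ : ∀ x, conjReal φ s + τ * (x - s) ≤ conjReal φ x) : τ = d := by
  have h1 : HasDerivAt (conjReal φ) d s := by
    simpa only [hφ.conjugate_psiHat, EReal.toReal_coe] using hd.2
  have h2 : HasDerivAt (fun x => conjReal φ x - τ * (x - s)) (d - τ * 1) s :=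
    h1.sub (((hasDerivAt_id s).sub_const s).const_mul τ)
  have h3 : IsLocalMin (fun x => conjReal φ x - τ * (x - s)) s :=
    Eventually.of_forall fun x => by
      have := hτ x
      simp only [sub_self, mul_zero, sub_zero]
      linarith
  have := h3.hasDerivAt_eq_zero h2
  linarith

/-- A nondecreasing penalty is exposed by nonnegative slopes. -/
lemma PenaltyFamily.exists_subgradient (hφ : PenaltyFamily φ) (hmono : MonotoneOn φ (Icc 0 1))
    {t : ℝ} (ht : t ∈ Icc (0 : ℝ) 1) :
    ∃ s, 0 ≤ s ∧ conjReal φ s = s * t - penaltyReal φ t := by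
  have hp : MonotoneOn (penaltyReal φ) (Icc 0 1) := fun x hx y hy hxy => by
    have := hmono hx hy hxy
    rwa [hφ.coe_penaltyReal (hφ.ne_top hx), hφ.coe_penaltyReal (hφ.ne_top hy),
      EReal.coe_le_coe_iff] at this
  have h0 : (0 : ℝ) ∈ Icc (0 : ℝ) 1 := ⟨le_rfl, zero_le_one⟩
  suffices h : ∃ s, 0 ≤ s ∧ ∀ t' ∈ Icc (0 : ℝ) 1,
      penaltyReal φ t + s * (t' - t) ≤ penaltyReal φ t' by
    obtain ⟨s, hs, h⟩ := h
    refine ⟨s, hs, le_antisymm ?_ ?_⟩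
    · obtain ⟨t', ht', he, -⟩ := hφ.exists_conjReal_eq s
      rw [he, abs_of_nonneg hs]
      linarith [h t' ht']
    · have := hφ.mul_sub_le_conjReal s ht
      rwa [abs_of_nonneg hs] at this
  -- At t = 0 the left derivative of φ may be negative, as φ is not controlled left of 0; slope 0
  -- works by monotonicity.
  rcases eq_or_lt_of_le ht.1 with rfl | htpos
  · exact ⟨0, le_rfl, fun t' ht' => by simpa using hp h0 ht' ht'.1⟩
  set s := derivWithin (penaltyReal φ) (Iio t) t with hs
  have hsub : ∀ t' ∈ Icc (0 : ℝ) 1, penaltyReal φ t + s * (t' - t) ≤ penaltyReal φ t' := by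
    intro t' ht'
    rcases lt_trichotomy t' t with h | rfl | h
    · have := hφ.convexOn.slope_le_leftDeriv_of_mem_interior (hφ.ne_top ht') (hφ.dom ht) h
      rw [slope_def_field, div_le_iff₀ (sub_pos.2 h)] at this
      linarith
    · simp
    · have := (hφ.convexOn.leftDeriv_le_rightDeriv_of_mem_interior (hφ.dom ht)).trans
        (hφ.convexOn.rightDeriv_le_slope_of_mem_interior (hφ.dom ht) (hφ.ne_top ht') h)
      rw [slope_def_field, le_div_iff₀ (sub_pos.2 h)] at this
      linarith
  refine ⟨s, ?_, hsub⟩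
  -- A negative slope would give φ(0) > φ(t), against monotonicity.
  have h1 := hsub 0 h0
  have h2 := hp h0 ht htpos.le
  by_contra! hneg
  nlinarith

/-! ### Spectral functions -/

/-- Equality of the sums for every `F` encodes equality as multisets; the indicator of (1, ∞) is the
`F` that counts entries above 1. -/
lemma le_one_of_sum_eq {a b : Fin m → ℝ}
    (h : ∀ F : ℝ → ℝ, ∑ i, F (a i) = ∑ i, F (b i)) (hb : ∀ i, b i ≤ 1) (i : Fin m) : a i ≤ 1 := by
  classical
  have h1 := h fun x => if x ≤ 1 then 0 else 1
  simp only [hb, if_true, Finset.sum_const_zero] at h1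
  rw [Finset.sum_eq_zero_iff_of_nonneg fun i _ => by split_ifs <;> norm_num] at h1
  have := h1 i (Finset.mem_univ i)
  by_contra hi
  simp [hi] at this

/-- Duality of the spectral and nuclear norms. The right side is linear in `Z`, so convexity of the
domain of F is immediate from it. -/
lemma forall_sigma_le_one_iff (hmn : m ≤ n) (Z : Mat m n) :
    (∀ i, sigma Z i ≤ 1) ↔ ∀ Y : Mat m n, inner ℝ Z Y ≤ ∑ i, sigma Y i := by
  constructor
  · intro h Y
    refine (inner_le_sum_sigma_mul_sigma hmn Z Y).trans (Finset.sum_le_sum fun i _ => ?_)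
    exact mul_le_of_le_one_left (sigma_nonneg Y i) (h i)
  · intro h i
    -- `Y` pairs the i-th singular vectors of `Z`: its nuclear norm is 1 and its inner product with
    -- `Z` is σ_i(Z).
    obtain ⟨Y, hY, hF⟩ := exists_simultaneous_svd hmn Z (Pi.single i 1)
    have h1 := h Y
    have h2 := hF id
    simp only [id] at h2
    have h3 : ∑ j, |(Pi.single i 1 : Fin m → ℝ) j| = 1 := by
      rw [Finset.sum_eq_single i] <;> simp +contextual
    rw [hY, h2, h3] at h1
    simpa [Pi.single_apply] using h1

lemma convex_sigma_le_one (hmn : m ≤ n) : Convex ℝ {Z : Mat m n | ∀ i, sigma Z i ≤ 1} := by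
  intro Z hZ W hW a b ha hb hab
  rw [mem_ofPred_eq, forall_sigma_le_one_iff hmn] at hZ hW ⊢
  intro Y
  rw [inner_add_left, inner_smul_left, inner_smul_left]
  simp only [conj_trivial]
  calc a * inner ℝ Z Y + b * inner ℝ W Y
      ≤ a * ∑ i, sigma Y i + b * ∑ i, sigma Y i := by gcongr <;> [exact hZ Y; exact hW Y]
    _ = ∑ i, sigma Y i := by rw [← add_mul, hab, one_mul]

lemma PenaltyFamily.PsiHat_sigma (hφ : PenaltyFamily φ) {Z : Mat m n}
    (hZ : ∀ i, sigma Z i ≤ 1) :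
    PsiHat φ (sigma Z) = ((∑ i, penaltyReal φ (sigma Z i) : ℝ) : EReal) := by
  rw [hφ.PsiHat_of_abs_le fun i => by rw [abs_of_nonneg (sigma_nonneg Z i)]; exact hZ i]
  simp only [abs_of_nonneg (sigma_nonneg Z _)]

lemma PenaltyFamily.PsiHat_sigma_eq_top (hφ : PenaltyFamily φ) {Z : Mat m n}
    (hZ : ¬ ∀ i, sigma Z i ≤ 1) : PsiHat φ (sigma Z) = ⊤ := by
  push Not at hZ
  obtain ⟨i, hi⟩ := hZ
  exact hφ.PsiHat_of_one_lt_abs (hi.trans_le (le_abs_self _))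

/-- The Fenchel–Young inequality for the spectral functions. -/
lemma PenaltyFamily.inner_le_add (hφ : PenaltyFamily φ) (hmn : m ≤ n) (Y : Mat m n) {Z : Mat m n}
    (hZ : ∀ i, sigma Z i ≤ 1) :
    inner ℝ Y Z ≤ ∑ i, conjReal φ (sigma Y i) + ∑ i, penaltyReal φ (sigma Z i) := by
  refine (inner_le_sum_sigma_mul_sigma hmn Y Z).trans ?_
  rw [← Finset.sum_add_distrib]
  refine Finset.sum_le_sum fun i _ => ?_
  have := hφ.mul_sub_le_conjReal (sigma Y i) ⟨sigma_nonneg Z i, hZ i⟩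
  rw [abs_of_nonneg (sigma_nonneg Y i)] at this
  linarith

/-- The supremum defining the conjugate of the spectral function is attained. -/
lemma PenaltyFamily.exists_inner_eq_add (hφ : PenaltyFamily φ) (hmn : m ≤ n) (Y : Mat m n) :
    ∃ Z : Mat m n, (∀ i, sigma Z i ≤ 1) ∧
      inner ℝ Y Z = ∑ i, conjReal φ (sigma Y i) + ∑ i, penaltyReal φ (sigma Z i) := by
  choose t ht he _ using fun i => hφ.exists_conjReal_eq (sigma Y i)
  obtain ⟨Z, hZ, hF⟩ := exists_simultaneous_svd hmn Y t
  simp only [abs_of_nonneg (ht _).1] at hF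
  refine ⟨Z, le_one_of_sum_eq hF fun i => (ht i).2, ?_⟩
  rw [hZ, hF, ← Finset.sum_add_distrib]
  refine Finset.sum_congr rfl fun i _ => ?_
  rw [he, abs_of_nonneg (sigma_nonneg Y i)]
  ring

/-- Gives an affine minorant of F exact at `Z`, built in the singular bases of `Z` from scalar
subgradients. Their nonnegativity matters, because singular values only retain |s_i|. -/
lemma PenaltyFamily.exists_inner_eq_add_of_monotoneOn (hφ : PenaltyFamily φ) (hmn : m ≤ n)
    (hmono : MonotoneOn φ (Icc 0 1)) {Z : Mat m n} (hZ : ∀ i, sigma Z i ≤ 1) :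
    ∃ Y : Mat m n,
      inner ℝ Y Z = ∑ i, conjReal φ (sigma Y i) + ∑ i, penaltyReal φ (sigma Z i) := by
  choose s hs he using fun i => hφ.exists_subgradient hmono ⟨sigma_nonneg Z i, hZ i⟩
  obtain ⟨Y, hY, hF⟩ := exists_simultaneous_svd hmn Z s
  refine ⟨Y, ?_⟩
  rw [real_inner_comm, hY, hF, ← Finset.sum_add_distrib]
  refine Finset.sum_congr rfl fun i _ => ?_
  rw [conjReal_abs, he]
  ring

lemma PenaltyFamily.mem_limSubdiff_conjugate (hφ : PenaltyFamily φ) (hmn : m ≤ n)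
    (hmono : MonotoneOn φ (Icc 0 1)) {Y W : Mat m n}
    (h : Y ∈ limSubdiff (fun Z : Mat m n => PsiHat φ (sigma Z)) W) :
    W ∈ limSubdiff (fun Z : Mat m n => conjugate (PsiHat φ) (sigma Z)) Y := by
  obtain ⟨hW, hsub⟩ := le_of_mem_limSubdiff (D := {Z : Mat m n | ∀ i, sigma Z i ≤ 1})
    (r := fun Z => ∑ i, penaltyReal φ (sigma Z i)) (convex_sigma_le_one hmn)
    (fun Z hZ => hφ.PsiHat_sigma hZ) (fun Z hZ => hφ.PsiHat_sigma_eq_top hZ)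
    (fun Z hZ => by
      obtain ⟨Y, hY⟩ := hφ.exists_inner_eq_add_of_monotoneOn hmn hmono hZ
      refine ⟨Y, fun Z' hZ' => ?_⟩
      rw [inner_sub_right, hY]
      linarith [hφ.inner_le_add hmn Y hZ']) h
  refine mem_limSubdiff_of_forall_le (hφ.conjugate_PsiHat _) fun Y' => ?_
  rw [hφ.conjugate_PsiHat, EReal.coe_le_coe_iff]
  -- Testing the subgradient inequality at a maximizer `Z` gives G(Y) + F(W) ≤ ⟨Y, W⟩, the reverse
  -- of Fenchel–Young.
  obtain ⟨Z, hZ, he⟩ := hφ.exists_inner_eq_add hmn Y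
  have h1 := hsub Z hZ
  have h2 := hφ.inner_le_add hmn Y' hW
  rw [inner_sub_right, real_inner_comm Z, real_inner_comm W] at h1
  rw [inner_sub_right]
  rw [real_inner_comm Z] at he
  rw [real_inner_comm W] at h2
  linarith

lemma PenaltyFamily.mem_limSubdiff_of_conjugate (hφ : PenaltyFamily φ) (hmn : m ≤ n)
    (hdiff : ∀ s : ℝ, 0 ≤ s → ∃ d, HasDerivAtE (conjugate (psiHat φ)) d s) {Y W : Mat m n}
    (h : W ∈ limSubdiff (fun Z : Mat m n => conjugate (PsiHat φ) (sigma Z)) Y) :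
    W ∈ spectralBall m n ∧ Y ∈ limSubdiff (fun Z : Mat m n => PsiHat φ (sigma Z)) W := by
  obtain ⟨-, hsub⟩ := le_of_mem_limSubdiff (D := (univ : Set (Mat m n)))
    (r := fun Z => ∑ i, conjReal φ (sigma Z i)) convex_univ
    (fun Z _ => hφ.conjugate_PsiHat _) (fun Z hZ => absurd (mem_univ Z) hZ)
    (fun Y _ => by
      obtain ⟨Z, hZ, he⟩ := hφ.exists_inner_eq_add hmn Y
      refine ⟨Z, fun Y' _ => ?_⟩
      rw [inner_sub_right, real_inner_comm Y', real_inner_comm Y, he]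
      linarith [hφ.inner_le_add hmn Y' hZ]) h
  -- Test matrices with the singular bases of `W` and diagonal `s`; signs of `s` are harmless
  -- because `conjReal φ` is even.
  have hvec : ∀ s : Fin m → ℝ, ∑ i, conjReal φ (sigma Y i) +
      (∑ i, sigma W i * s i - inner ℝ W Y) ≤ ∑ i, conjReal φ (s i) := fun s => by
    obtain ⟨Y', hY', hF⟩ := exists_simultaneous_svd hmn W s
    have := hsub Y' (mem_univ _)
    rw [inner_sub_right, hY', hF] at this
    simpa using this
  have hvN := inner_le_sum_sigma_mul_sigma hmn W Y
  -- Taking s = σ(Y) forces equality in von Neumann's inequality.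
  have heq : inner ℝ W Y = ∑ i, sigma W i * sigma Y i :=
    le_antisymm hvN (by linarith [hvec (sigma Y)])
  have hcoord : ∀ i x, conjReal φ (sigma Y i) + sigma W i * (x - sigma Y i) ≤ conjReal φ x := by
    intro i x
    have h1 := hvec (Function.update (sigma Y) i x)
    rw [heq] at h1
    have h2 : ∀ g : Fin m → ℝ → ℝ, ∑ j, g j (Function.update (sigma Y) i x j) =
        ∑ j, g j (sigma Y j) + (g i x - g i (sigma Y i)) := fun g => by
      rw [← Finset.add_sum_erase _ _ (Finset.mem_univ i),
        ← Finset.add_sum_erase _ (fun j => g j (sigma Y j)) (Finset.mem_univ i),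
        Function.update_self, Finset.sum_congr rfl fun j hj => by
          rw [Function.update_of_ne (Finset.ne_of_mem_erase hj)]]
      ring
    rw [h2 fun j y => sigma W j * y, h2 fun _ y => conjReal φ y] at h1
    linarith
  have hW : ∀ i, sigma W i ≤ 1 ∧
      conjReal φ (sigma Y i) = sigma Y i * sigma W i - penaltyReal φ (sigma W i) := by
    intro i
    obtain ⟨d, hd⟩ := hdiff (sigma Y i) (sigma_nonneg Y i)
    obtain ⟨t, ht, he, -⟩ := hφ.exists_conjReal_eq (sigma Y i)
    rw [abs_of_nonneg (sigma_nonneg Y i)] at he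
    -- The maximizer `t` and σ_i(W) are both subgradients of ψ̂* at σ_i(Y), so both equal the
    -- derivative; this places σ_i(W) in [0,1] and makes it a maximizer.
    have htd : t = d := hφ.eq_of_hasDerivAtE hd fun x => by
      have h1 := hφ.mul_sub_le_conjReal x ht
      have h2 := mul_le_mul_of_nonneg_right (le_abs_self x) ht.1
      rw [he]
      linarith
    have hWd : sigma W i = d := hφ.eq_of_hasDerivAtE hd (hcoord i)
    rw [hWd, ← htd]
    exact ⟨ht.2, he⟩
  refine ⟨mem_spectralBall_of_sigma_le_one hmn fun i => (hW i).1,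
    mem_limSubdiff_of_forall_le (hφ.PsiHat_sigma fun i => (hW i).1) fun Z => ?_⟩
  by_cases hZ : ∀ i, sigma Z i ≤ 1
  · rw [hφ.PsiHat_sigma hZ, EReal.coe_le_coe_iff, inner_sub_right, real_inner_comm W, heq]
    have h1 := hφ.inner_le_add hmn Y hZ
    have h2 : ∑ i, conjReal φ (sigma Y i) =
        ∑ i, sigma W i * sigma Y i - ∑ i, penaltyReal φ (sigma W i) := by
      rw [← Finset.sum_sub_distrib]
      exact Finset.sum_congr rfl fun i _ => by rw [(hW i).2, mul_comm]
    linarith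
  · rw [hφ.PsiHat_sigma_eq_top hZ]
    exact le_top

end Penalty

end RankReg

theorem mainTheorem7 {m n : ℕ} (hmn : m ≤ n) (ν : ℝ) (hν : 0 < ν)
    (f : RankReg.Mat m n → ℝ) (hf : LocallyLipschitz f)
    (Ω : Set (RankReg.Mat m n)) (hΩ_closed : IsClosed Ω) (hΩ_convex : Convex ℝ Ω)
    (hf_reg : ∀ X ∈ Ω, RankReg.regSubdiff (fun Z : RankReg.Mat m n => ((f Z : ℝ) : EReal)) X =
      RankReg.limSubdiff (fun Z : RankReg.Mat m n => ((f Z : ℝ) : EReal)) X)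
    (φ : ℝ → EReal) (hφ : RankReg.PenaltyFamily φ) (X : RankReg.Mat m n) :
    (RankReg.ConjugateCondition φ →
      RankReg.IsDCStationary ν f Ω φ X → RankReg.IsEPStationary ν f Ω φ X) ∧
    (MonotoneOn φ (Set.Icc 0 1) →
      RankReg.IsEPStationary ν f Ω φ X → RankReg.IsDCStationary ν f Ω φ X) := by
  constructor
  -- The same ρ and W serve in both directions; beyond subgradient inversion only the regrouping ρC
  -- - ρW = ρ(C - W) remains.
  · rintro hC ⟨ρ, hρ, A, ⟨B, hB, N, ⟨C, hC', rfl⟩, rfl⟩, D, ⟨W, hW, rfl⟩, h0⟩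
    obtain ⟨hball, hsub⟩ := hφ.mem_limSubdiff_of_conjugate hmn hC.differentiable hW
    refine ⟨ρ, hρ, W, hball, hsub, B, hB, ρ • (C - W),
      ⟨C - W, Set.sub_mem_sub hC' rfl, rfl⟩, ?_⟩
    rw [← h0]
    simp only [smul_sub]
    abel
  · rintro hmono ⟨ρ, hρ, W, -, hsub, B, hB, D, ⟨E, ⟨C, hC, W', rfl, rfl⟩, rfl⟩, h0⟩
    refine ⟨ρ, hρ, B + ρ • C, ⟨B, hB, ρ • C, ⟨C, hC, rfl⟩, rfl⟩, ρ • W',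
      ⟨W', hφ.mem_limSubdiff_conjugate hmn hmono hsub, rfl⟩, ?_⟩
    rw [← h0]
    simp only [smul_sub]
    abel
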